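/- Let $F$ be a field of characteristic $0$ and let $L$ be a finite-dimensional Lie algebra over $F$. Call a Lie algebra $M$ over $F$ *toral* if the endomorphism $\mathrm{ad}_x\colon y\mapsto [x,y]$ of $M$ is semisimple for every $x\in M$. Call $L$ *pluperfect* if for every ideal $I$ of $L$ such that $L/I$ is toral, the quotient $L/I$ is trivial (zero). Call a nonzero element $y\in L$ *inertial* if there exist $x\in L$ and a nonzero $\lambda\in F$ with $[x,y]=\lambda y$, and call $L$ *inertially generated* if it has an $F$-basis $\{y_1,\dots,y_d\}$ all of whose elements are inertial. Theorem. Every pluperfect $L$ is inertially generated. Conversely, every inertially generated $L$ is pluperfect. Thus $L$ is pluperfect if and only if it is inertially generated. -/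

import Mathlib

/-- A Lie algebra `L` over `F` is toral if `ad_x` is a semisimple endomorphism of `L` (every
invariant subspace has an invariant complement) for every `x ∈ L`. -/
def LieAlgebra.IsToral (F L : Type*) [Field F] [LieRing L] [LieAlgebra F L] : Prop :=
  ∀ x : L, (LieAlgebra.ad F L x).IsSemisimple

/-- A Lie algebra `L` is pluperfect if every toral quotient `L ⧸ I` is trivial. -/
def LieAlgebra.IsPluperfect (F L : Type*) [Field F] [LieRing L] [LieAlgebra F L] : Prop :=
  ∀ I : LieIdeal F L, LieAlgebra.IsToral F (L ⧸ I) → Subsingleton (L ⧸ I)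

/-- A (necessarily nonzero) element `y` is inertial if it is an eigenvector of `ad_x`, with
nonzero eigenvalue in `F`, for some `x ∈ L`. -/
def LieAlgebra.IsInertial (F : Type*) {L : Type*} [Field F] [LieRing L] [LieAlgebra F L]
    (y : L) : Prop :=
  ∃ (x : L) (c : F), c ≠ 0 ∧ (LieAlgebra.ad F L x).HasEigenvector c y

/-- A (finite-dimensional) Lie algebra `L` is inertially generated if it has an `F`-basis
`y_1, …, y_d` consisting of inertial elements. -/
def LieAlgebra.IsInertiallyGenerated (F L : Type*) [Field F] [LieRing L] [LieAlgebra F L] : Prop :=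
  ∃ (d : ℕ) (b : Module.Basis (Fin d) F L), ∀ i, LieAlgebra.IsInertial F (b i)

/-!
Call `y` inertial if it is an eigenvector of some `ad x` for a nonzero eigenvalue in the ground
field.

An inertial `y` is ad-nilpotent in characteristic zero, and its image in any quotient is zero or
inertial. In a toral quotient, `ad y` is both nilpotent and semisimple, hence zero, whereas an
inertial element is not central. So inertial elements die in toral quotients, and a Lie algebra
which they span is pluperfect (`IsInertiallyGenerated.isPluperfect`).

For the converse, the source of inertial elements are the `sl₂`-triples `h, e, f` in `L`. By the
representation theory of `sl₂`, `ad h` is diagonalizable over the ground field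
(`iSup_eigenspace_eq_top_of_slTwo`). Its eigenspaces for nonzero eigenvalues consist of inertial
elements, and the ideal they generate is the sum of these eigenspaces and of the brackets of two of
them. A bracket `⁅a, b⁆` of eigenvectors for opposite eigenvalues is in the span of the inertial
elements as well, because `exp (ad a) b` is inertial and all the terms of its expansion other than
`⁅a, b⁆` are eigenvectors for nonzero eigenvalues. Hence there is an ideal `J`, contained in the
span of the inertial elements, which contains the element `e` of every `sl₂`-triple
(`exists_lieIdeal_le_inertialSpan_of_isNilpositive`).

Let `L` be pluperfect with radical `R`. The quotient `L ⧸ R` has a nondegenerate Killing form, so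
each of its elements is the sum of an ad-semisimple and an ad-nilpotent element
(`exists_ad_isSemisimple_isNilpotent`). By the Jacobson-Morozov theorem the ad-nilpotent summand
belongs to an `sl₂`-triple (`isNilpositive_of_isNilpotent_ad`), and such triples lift along
`L → L ⧸ R` since `R` is solvable (`exists_isNilpositive_of_isSolvable`). The nilpotent summand
therefore vanishes modulo `J ⊔ R`: the quotient `L ⧸ (J ⊔ R)` is toral, hence zero. So
`L = J + R` is solvable modulo `J`. As `L` is perfect (an abelian quotient is toral), `J = ⊤`,
and the inertial elements span `L`.
-/

/-! ### Eigenspaces and semisimple endomorphisms -/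

section LinearAlgebra

variable {K V : Type*} [Field K] [AddCommGroup V] [Module K V]

open Module.End in
/-- A generalized eigenvector that is a sum of eigenvectors is an eigenvector. -/
theorem eigenspace_of_mem_iSup_eigenspace {H : Module.End K V} {c : K} {v : V}
    (hv : v ∈ ⨆ μ, eigenspace H μ) (h : H v - c • v ∈ eigenspace H c) : v ∈ eigenspace H c := by
  have hle : (⨆ μ, eigenspace H μ) ≤ eigenspace H c ⊔ ⨆ μ, ⨆ _ : μ ≠ c, eigenspace H μ := by
    refine iSup_le fun μ ↦ ?_
    by_cases hμ : μ = c
    · exact hμ ▸ le_sup_left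
    · exact le_sup_of_le_right (le_iSup₂_of_le μ hμ le_rfl)
  obtain ⟨x, hx, y, hy, rfl⟩ := Submodule.mem_sup.mp (hle hv)
  have hdisj := H.eigenspaces_iSupIndep c
  have hstab : (⨆ μ, ⨆ _ : μ ≠ c, eigenspace H μ) ≤
      (⨆ μ, ⨆ _ : μ ≠ c, eigenspace H μ).comap (H - c • 1) := by
    refine iSup₂_le fun μ hμ z hz ↦ ?_
    rw [Submodule.mem_comap]
    refine (le_iSup₂_of_le (f := fun μ _ ↦ eigenspace H μ) μ hμ le_rfl :
      eigenspace H μ ≤ _) ?_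
    simp only [LinearMap.sub_apply, LinearMap.smul_apply, Module.End.one_apply]
    rw [mem_eigenspace_iff.mp hz, ← sub_smul]
    exact Submodule.smul_mem _ _ hz
  have h1 : H y - c • y ∈ ⨆ μ, ⨆ _ : μ ≠ c, eigenspace H μ := hstab hy
  have h2 : H (x + y) - c • (x + y) = H y - c • y := by
    rw [map_add, mem_eigenspace_iff.mp hx]; module
  have h3 := Submodule.disjoint_def.mp hdisj _ (h2 ▸ h) h1
  exact add_mem hx (mem_eigenspace_iff.mpr (sub_eq_zero.mp h3))

open Module.End in
/-- Modulo the image of `H - c`, a sum of eigenvectors is an eigenvector for the eigenvalue `c`. -/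
theorem exists_sub_mem_eigenspace {H : Module.End K V} (c : K) {v : V}
    (hv : v ∈ ⨆ μ, eigenspace H μ) :
    ∃ w ∈ ⨆ μ, eigenspace H μ, v - (H w - c • w) ∈ eigenspace H c := by
  induction hv using Submodule.iSup_induction' with
  | mem μ x hx =>
    by_cases hμ : μ = c
    · exact ⟨0, zero_mem _, by simpa [← hμ] using hx⟩
    · refine ⟨(μ - c)⁻¹ • x, Submodule.smul_mem _ _ (Submodule.mem_iSup_of_mem μ hx), ?_⟩
      rw [map_smul, mem_eigenspace_iff.mp hx, smul_comm c, ← smul_sub, ← sub_smul,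
        inv_smul_smul₀ (sub_ne_zero.mpr hμ), sub_self]
      exact zero_mem _
  | zero => exact ⟨0, zero_mem _, by simp⟩
  | add x y _ _ hx hy =>
    obtain ⟨w, hw, h1⟩ := hx
    obtain ⟨w', hw', h2⟩ := hy
    refine ⟨w + w', add_mem hw hw', ?_⟩
    convert add_mem h1 h2 using 1
    rw [map_add]; module

theorem Module.End.IsSemisimple.of_surjective {W : Type*}
    [FiniteDimensional K V] [AddCommGroup W] [Module K W] {f : Module.End K V} {g : Module.End K W}
    (hf : f.IsSemisimple) (π : V →ₗ[K] W) (hπ : Function.Surjective π)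
    (h : ∀ v, π (f v) = g (π v)) : g.IsSemisimple := by
  refine Module.End.isSemisimple_of_squarefree_aeval_eq_zero hf.minpoly_squarefree ?_
  -- The minimal polynomial of `f` is squarefree and annihilates `g`.
  have key (p : Polynomial K) (v : V) :
      π (Polynomial.aeval f p v) = Polynomial.aeval g p (π v) := by
    induction p using Polynomial.induction_on' with
    | add p q hp hq => simp [hp, hq]
    | monomial n a =>
      have (n : ℕ) : π ((f ^ n) v) = (g ^ n) (π v) := by
        induction n with
        | zero => simp
        | succ n ih =>
          rw [pow_succ', Module.End.mul_apply, h, ih, pow_succ', Module.End.mul_apply]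
      simp [Polynomial.aeval_monomial, this]
  ext w
  obtain ⟨v, rfl⟩ := hπ w
  rw [← key, minpoly.aeval]
  simp

theorem Module.End.mem_invtSubmodule_of_mem_adjoin
    {f g : Module.End K V} {p : Submodule K V} (hf : p ∈ f.invtSubmodule)
    (hg : g ∈ Algebra.adjoin K {f}) : p ∈ g.invtSubmodule := by
  induction hg using Algebra.adjoin_induction with
  | mem x hx => rwa [Set.mem_singleton_iff.mp hx]
  | algebraMap r => exact fun v hv ↦ p.smul_mem r hv
  | add x y _ _ hx hy => exact fun v hv ↦ p.add_mem (hx hv) (hy hv)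
  | mul x y _ _ hx hy => exact fun v hv ↦ hx (hy hv)

variable [CharZero K]

theorem Module.End.isNilpotent_of_commutator_eq_smul [FiniteDimensional K V]
    {X Y : Module.End K V} {c : K} (hc : c ≠ 0) (h : X * Y - Y * X = c • Y) :
    IsNilpotent Y := by
  by_contra hY
  have hpow (k : ℕ) : X * Y ^ k - Y ^ k * X = (k * c) • Y ^ k := by
    induction k with
    | zero => simp
    | succ k ih =>
      have : X * Y ^ (k + 1) - Y ^ (k + 1) * X
          = (X * Y ^ k - Y ^ k * X) * Y + Y ^ k * (X * Y - Y * X) := by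
        rw [pow_succ]; noncomm_ring
      rw [this, ih, h, smul_mul_assoc, mul_smul_comm, ← pow_succ, ← add_smul]
      push_cast
      ring_nf
  -- If no power of `Y` vanished, each `Y ^ k` would be an eigenvector of `[X, ·]`, for the
  -- eigenvalue `k * c`.
  let D : Module.End K (Module.End K V) := LinearMap.mulLeft K X - LinearMap.mulRight K X
  have hD (k : ℕ) : D.HasEigenvalue (k * c) := by
    refine Module.End.hasEigenvalue_of_hasEigenvector (x := Y ^ k)
      ⟨Module.End.mem_eigenspace_iff.mpr (hpow k), fun h0 ↦ hY ⟨k, h0⟩⟩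
  have hinj : Function.Injective fun k : ℕ ↦ (k : K) * c := fun a b hab ↦ by
    simpa [hc] using hab
  exact (Set.infinite_range_of_injective hinj)
    (D.finite_hasEigenvalue.subset (by rintro _ ⟨k, rfl⟩; exact hD k))

/-- If `u` is nilpotent and `[u, [u, v]] = 0`, then `u * v` is nilpotent, so its trace vanishes. -/
theorem LinearMap.trace_mul_eq_zero_of_isNilpotent [FiniteDimensional K V]
    {u v : Module.End K V}
    (hu : IsNilpotent u) (h : Commute u (u * v - v * u)) : LinearMap.trace K V (u * v) = 0 := by
  set w := u * v - v * u with hw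
  -- The derivation `D = [u, ·]` is nilpotent and `D v = w`, `D w = 0`, whence
  -- `(D ^ n) (v ^ n) = n! • w ^ n` and `w` is nilpotent.
  have hwn : IsNilpotent w := by
    let D : Module.End K (Module.End K V) := LinearMap.mulLeft K u - LinearMap.mulRight K u
    have hD (x : Module.End K V) : D x = u * x - x * u := rfl
    obtain ⟨N, hN⟩ : IsNilpotent D := by
      refine (LinearMap.commute_mulLeft_right (R := K) u u).isNilpotent_sub ?_ ?_
      · rwa [LinearMap.isNilpotent_mulLeft_iff]
      · rwa [LinearMap.isNilpotent_mulRight_iff]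
    have hDv (x : Module.End K V) (n : ℕ) :
        (D ^ (n + 1)) (v * x) = v * (D ^ (n + 1)) x + ((n : K) + 1) • (w * (D ^ n) x) := by
      have hDw (x : Module.End K V) : D (w * x) = w * D x := by
        rw [hD, hD, ← mul_assoc, h.eq]; noncomm_ring
      have hDv' (x : Module.End K V) : D (v * x) = v * D x + w * x := by
        rw [hD, hD, hw]; noncomm_ring
      induction n with
      | zero => simp [hDv']
      | succ n ih =>
        rw [pow_succ', Module.End.mul_apply, ih, map_add, map_smul, hDw, hDv',
          ← Module.End.mul_apply, ← Module.End.mul_apply, ← pow_succ', ← pow_succ']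
        push_cast
        module
    have key (n : ℕ) : (D ^ n) (v ^ n) = (n.factorial : K) • w ^ n ∧ (D ^ (n + 1)) (v ^ n) = 0 := by
      induction n with
      | zero => simp [hD, Module.End.one_apply]
      | succ n ih =>
        refine ⟨?_, ?_⟩
        · rw [pow_succ' v, hDv, ih.1, ih.2, mul_zero, zero_add, Nat.factorial_succ,
            mul_smul_comm, ← pow_succ']
          push_cast
          module
        · rw [pow_succ' v, hDv, ih.2, pow_succ', Module.End.mul_apply, ih.2]
          simp
    refine ⟨N, ?_⟩
    have := (key N).1
    rw [hN, LinearMap.zero_apply, eq_comm, smul_eq_zero] at this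
    exact this.resolve_left (by exact_mod_cast N.factorial_ne_zero)
  obtain ⟨k, hk⟩ := hwn
  obtain ⟨N, hN⟩ := hu
  -- On `range (u ^ p) / range (u ^ (p + 1))` the map `u * v` acts as the nilpotent `-p • w`, so
  -- `u * v` is nilpotent.
  have hvu (p : ℕ) : u * v * u ^ p = u ^ p * (u * v - (p : K) • w) := by
    induction p with
    | zero => simp
    | succ p ih =>
      rw [pow_succ, ← mul_assoc, ih, mul_assoc, mul_assoc, sub_mul, smul_mul_assoc, ← h.eq]
      have : u * v * u = u * (u * v - w) := by rw [hw]; noncomm_ring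
      rw [this]
      congr 1
      simp only [mul_sub, mul_smul_comm, Nat.cast_add, Nat.cast_one]
      module
  suffices hnil : ∀ i p, i + p = N → ∃ m, (u * v) ^ m * u ^ p = 0 by
    obtain ⟨m, hm⟩ := hnil N 0 rfl
    exact (LinearMap.isNilpotent_trace_of_isNilpotent ⟨m, by simpa using hm⟩).eq_zero
  intro i
  induction i with
  | zero =>
    rintro p hp
    exact ⟨0, by rw [show p = N by omega, hN, mul_zero]⟩
  | succ i ih =>
    intro p hp
    obtain ⟨m, hm⟩ := ih (p + 1) (by omega)
    have hj (j : ℕ) : ∃ X,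
        (u * v) ^ j * u ^ p = u ^ (p + 1) * X + (-p : K) ^ j • (u ^ p * w ^ j) := by
      induction j with
      | zero => exact ⟨0, by simp⟩
      | succ j ihj =>
        obtain ⟨X, hX⟩ := ihj
        refine ⟨(u * v - ((p + 1 : ℕ) : K) • w) * X + (-p : K) ^ j • (v * w ^ j), ?_⟩
        rw [pow_succ', mul_assoc, hX, mul_add, ← mul_assoc, hvu, mul_smul_comm, ← mul_assoc, hvu,
          pow_succ' w, pow_succ u, pow_succ (-p : K)]
        simp only [mul_add, mul_sub, sub_mul, mul_assoc, smul_mul_assoc, mul_smul_comm]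
        module
    obtain ⟨X, hX⟩ := hj k
    refine ⟨m + k, ?_⟩
    rw [pow_add, mul_assoc, hX, hk, mul_zero, smul_zero, add_zero, ← mul_assoc, hm, zero_mul]

/-! ### Representations of `sl₂`

The relations `[E, F] = H`, `[H, E] = 2 E` and `[H, F] = -2 F` are expressed pointwise. -/

variable {E F H : Module.End K V}

theorem pow_succ_apply_of_commutator
    (hEF : ∀ v, E (F v) = F (E v) + H v) (hHE : ∀ v, H (E v) = E (H v) + (2 : K) • E v)
    (j : ℕ) (v : V) :
    (E ^ (j + 1)) (F v) = F ((E ^ (j + 1)) v) + ((j : K) + 1) • (E ^ j) (H v + (j : K) • v) := by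
  induction j generalizing v with
  | zero => simp [hEF]
  | succ j ih =>
    rw [pow_succ, Module.End.mul_apply, hEF, map_add, ih, hHE, pow_succ E j]
    simp only [map_add, map_smul, Module.End.mul_apply]
    push_cast
    module

theorem pow_apply_of_commutator (hHE : ∀ v, H (E v) = E (H v) + (2 : K) • E v)
    (j : ℕ) (v : V) : H ((E ^ j) v) = (E ^ j) (H v) + (2 * j : K) • (E ^ j) v := by
  induction j generalizing v with
  | zero => simp
  | succ j ih =>
    rw [pow_succ, Module.End.mul_apply, ih, hHE]
    simp only [map_add, map_smul, Module.End.mul_apply]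
    push_cast
    module

/-- Induction along the filtration of the kernel of a nilpotent `E` by the ranges of the powers
`E ^ j`, everything taken modulo a stable submodule `U`: on the kernel, `H - j` maps the range of
`E ^ j` to that of `E ^ (j + 1)`. The relation `[H, F] = -2 F` is not required. -/
theorem ker_induction {N : ℕ} (hN : E ^ N = 0)
    (hEF : ∀ v, E (F v) = F (E v) + H v) (hHE : ∀ v, H (E v) = E (H v) + (2 : K) • E v)
    (U : Submodule K V) (hUE : ∀ v ∈ U, E v ∈ U) (hUF : ∀ v ∈ U, F v ∈ U)
    (hUH : ∀ v ∈ U, H v ∈ U) (P : ℕ → Submodule K V) (hUP : ∀ j, U ≤ P j)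
    (step : ∀ (j : ℕ) (v : V), E v ∈ U → H v - (j : K) • v ∈ P (j + 1) → v ∈ P j)
    {v : V} (hv : E v ∈ U) : v ∈ P 0 := by
  -- Descending induction on `j`, over the vectors lying in the range of `E ^ j` modulo `U`.
  suffices ∀ i j, i + j = N → ∀ v, E v ∈ U → (∃ b, v - (E ^ j) b ∈ U) → v ∈ P j from
    this N 0 rfl v hv ⟨v, by simp⟩
  intro i
  induction i with
  | zero =>
    rintro j hj v - ⟨b, hb⟩
    obtain rfl : j = N := by omega
    exact hUP _ (by simpa [hN] using hb)
  | succ i ih =>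
    rintro j hj v hv ⟨b, hb⟩
    refine step j v hv (ih (j + 1) (by omega) _ ?_ ⟨((j : K) + 1)⁻¹ • F b, ?_⟩)
    · rw [map_sub, map_smul, ← sub_eq_iff_eq_add.mpr (hHE v)]
      exact sub_mem (sub_mem (hUH _ hv) (U.smul_mem _ hv)) (U.smul_mem _ hv)
    · have hj0 : (j : K) + 1 ≠ 0 := by exact_mod_cast Nat.succ_ne_zero j
      obtain ⟨u, hu, rfl⟩ : ∃ u ∈ U, v = u + (E ^ j) b := ⟨_, hb, by simp⟩
      have h1 : (E ^ (j + 1)) b ∈ U := by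
        rw [pow_succ', Module.End.mul_apply]
        simpa using sub_mem hv (hUE _ hu)
      have h2 : H (u + (E ^ j) b) - (j : K) • (u + (E ^ j) b)
          - (E ^ (j + 1)) (((j : K) + 1)⁻¹ • F b)
          = (H u - (j : K) • u) - ((j : K) + 1)⁻¹ • F ((E ^ (j + 1)) b) := by
        rw [map_smul, pow_succ_apply_of_commutator hEF hHE, smul_add (_⁻¹), inv_smul_smul₀ hj0,
          map_add, map_add, pow_apply_of_commutator hHE, map_smul]
        module
      rw [h2]
      exact sub_mem (sub_mem (hUH _ hu) (U.smul_mem _ hu)) (U.smul_mem _ (hUF _ h1))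

/-- `E` maps the weight space of weight `k - 2` onto that of weight `k`, if `-k` is not in `ℕ`. -/
theorem exists_apply_eq_of_eigenvector
    (hEF : ∀ v, E (F v) = F (E v) + H v) (hHE : ∀ v, H (E v) = E (H v) + (2 : K) • E v)
    (hHF : ∀ v, H (F v) = F (H v) - (2 : K) • F v) {k : K} (hk : ∀ j : ℕ, k + j ≠ 0)
    (j : ℕ) {v : V} (hj : (E ^ j) v = 0) (hv : H v = k • v) :
    ∃ u, H u = (k - 2) • u ∧ E u = v := by
  induction j generalizing v with
  | zero => exact ⟨0, by simp, by simpa using hj.symm⟩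
  | succ j ih =>
    have hj0 : (j : K) + 1 ≠ 0 := by exact_mod_cast Nat.succ_ne_zero j
    set c : K := (j + 1) * (k + j) with hc_def
    have hc : c ≠ 0 := mul_ne_zero hj0 (hk j)
    -- `E ^ j` sends both `E (F v)` and `c • v` to `c • (E ^ j) v`.
    obtain ⟨u, hu, hEu⟩ := ih (v := E (F v) - c • v) (by
        rw [map_sub, map_smul, ← Module.End.mul_apply, ← pow_succ,
          pow_succ_apply_of_commutator hEF hHE, hj, hv]
        simp only [map_add, map_smul, map_zero]
        module) (by
        rw [map_sub, map_smul, hHE, hHF, hv]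
        simp only [map_sub, map_smul]
        module)
    refine ⟨c⁻¹ • (F v - u), ?_, ?_⟩
    · rw [map_smul, map_sub, hHF, hv, hu, map_smul]
      module
    · rw [map_smul, map_sub, hEu, sub_sub_cancel, inv_smul_smul₀ hc]

/-- The weight space of weight `2` is in the range of `E ^ 2`. -/
theorem exists_apply_apply_eq_of_eigenvector_two
    (hEF : ∀ v, E (F v) = F (E v) + H v) (hHE : ∀ v, H (E v) = E (H v) + (2 : K) • E v)
    (hHF : ∀ v, H (F v) = F (H v) - (2 : K) • F v)
    (j : ℕ) {v : V} (hj : (E ^ j) v = 0) (hv : H v = (2 : K) • v) :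
    ∃ u, E (E u) = v := by
  induction j generalizing v with
  | zero => exact ⟨0, by simpa using hj.symm⟩
  | succ j ih =>
    have hj1 : (j : K) + 1 ≠ 0 := by exact_mod_cast Nat.succ_ne_zero j
    have hj2 : (j : K) + 2 ≠ 0 := by exact_mod_cast Nat.succ_ne_zero (j + 1)
    set c : K := (j + 1) ^ 2 * (j + 2) ^ 2 with hc_def
    have hc : c ≠ 0 := mul_ne_zero (pow_ne_zero 2 hj1) (pow_ne_zero 2 hj2)
    have hHFv : H (F v) = 0 := by rw [hHF, hv]; simp
    have hj' : (E ^ (j + 2)) v = 0 := by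
      rw [pow_succ', Module.End.mul_apply, hj, map_zero]
    have e1 : (E ^ (j + 1)) (F v) = (((j : K) + 1) * (j + 2)) • (E ^ j) v := by
      rw [pow_succ_apply_of_commutator hEF hHE, hj, hv]
      simp only [map_add, map_smul, map_zero]
      module
    have e2 : (E ^ (j + 2)) (F v) = 0 := by
      rw [pow_succ', Module.End.mul_apply, e1, map_smul, ← Module.End.mul_apply, ← pow_succ', hj,
        smul_zero]
    -- `E ^ j` sends both `E (E (F (F v)))` and `c • v` to `c • (E ^ j) v`.
    obtain ⟨u, hu⟩ := ih (v := E (E (F (F v))) - c • v) (by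
        rw [map_sub, map_smul, ← Module.End.mul_apply, ← pow_succ, ← Module.End.mul_apply,
          ← pow_succ, pow_succ_apply_of_commutator hEF hHE, e2, hHFv]
        simp only [map_zero, zero_add, map_smul, e1]
        push_cast
        module) (by
        rw [map_sub, map_smul, hHE, hHE, hHF, hHFv, hv]
        simp only [map_add, map_sub, map_smul, map_zero]
        module)
    exact ⟨c⁻¹ • (F (F v) - u), by
      rw [map_smul, map_smul, map_sub, map_sub, hu, sub_sub_cancel, inv_smul_smul₀ hc]⟩

open Module.End in
/-- In a representation of `sl₂` on which `E` is nilpotent, `H` is diagonalizable. -/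
theorem iSup_eigenspace_eq_top_of_slTwo {N : ℕ} (hN : E ^ N = 0)
    (hEF : ∀ v, E (F v) = F (E v) + H v) (hHE : ∀ v, H (E v) = E (H v) + (2 : K) • E v)
    (hHF : ∀ v, H (F v) = F (H v) - (2 : K) • F v) :
    ⨆ μ, eigenspace H μ = ⊤ := by
  set U := ⨆ μ, eigenspace H μ with hU
  have stab (G : Module.End K V) (d : K) (hG : ∀ v, H (G v) = G (H v) + d • G v) :
      ∀ v ∈ U, G v ∈ U := by
    suffices U ≤ U.comap G from this
    refine iSup_le fun μ z hz ↦ ?_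
    refine Submodule.mem_iSup_of_mem (μ + d) (mem_eigenspace_iff.mpr ?_)
    rw [hG, mem_eigenspace_iff.mp hz, map_smul, add_smul]
  have hUE := stab E 2 hHE
  have hUF := stab F (-2) fun v ↦ by rw [hHF]; module
  have hUH := stab H 0 fun v ↦ by simp
  -- As `E` is nilpotent and `U` is a submodule, it suffices that `E v ∈ U` implies `v ∈ U`.
  have key : ∀ v, E v ∈ U → v ∈ U := by
    intro v hv
    refine ker_induction hN hEF hHE U hUE hUF hUH (fun _ ↦ U) (fun _ ↦ le_rfl) ?_ hv
    intro m v hv hmv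
    obtain ⟨w, hw, hwm⟩ := exists_sub_mem_eigenspace (m : K) hmv
    suffices v - w ∈ U by simpa using add_mem this hw
    obtain ⟨v', rfl⟩ : ∃ v', v = v' + w := ⟨v - w, by simp⟩
    rw [add_sub_cancel_right]
    have hv' : E v' ∈ U := by simpa using sub_mem hv (hUE w hw)
    have hwm' : H v' - (m : K) • v' ∈ eigenspace H m := by
      convert hwm using 1
      rw [map_add]; module
    -- After this correction by `w ∈ U`, `v'` is a generalized eigenvector of weight `m`, and `E v'`
    -- is a true eigenvector of weight `m + 2 > 0`, hence the image of one of weight `m`.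
    have hEv : H (E v') = ((m : K) + 2) • E v' := by
      refine mem_eigenspace_iff.mp (eigenspace_of_mem_iSup_eigenspace hv' ?_)
      have : H (E v') - ((m : K) + 2) • E v' = E (H v' - (m : K) • v') := by
        rw [hHE, map_sub, map_smul]; module
      rw [this, mem_eigenspace_iff, hHE, mem_eigenspace_iff.mp hwm', map_smul, add_smul]
    obtain ⟨u, hu, hEu⟩ := exists_apply_eq_of_eigenvector hEF hHE hHF
      (fun j ↦ by exact_mod_cast (by omega : m + 2 + j ≠ 0)) N (by simp [hN]) hEv
    have hker : E (v' - u) = 0 := by rw [map_sub, hEu, sub_self]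
    have huU : u ∈ U := Submodule.mem_iSup_of_mem _ (mem_eigenspace_iff.mpr hu)
    suffices v' - u ∈ U by simpa using add_mem this huU
    -- The kernel of `E` is a sum of eigenspaces for natural eigenvalues.
    let P (j : ℕ) : Submodule K V := ⨆ i : ℕ, ⨆ _ : j ≤ i, eigenspace H (i : K)
    have hP (j : ℕ) : P j ≤ U := iSup₂_le fun i _ ↦ le_iSup (fun μ ↦ eigenspace H μ) (i : K)
    refine hP 0 (ker_induction hN hEF hHE ⊥ (by simp) (by simp) (by simp) P (by simp) ?_
      (by simpa using hker))
    intro j x _ hx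
    suffices h : ∀ y ∈ P (j + 1), ∃ z ∈ P (j + 1), H z - (j : K) • z = y by
      obtain ⟨z, hz, hzx⟩ := h _ hx
      have hle : P (j + 1) ≤ P j := iSup₂_le fun i hi ↦
        le_iSup₂_of_le (f := fun (i : ℕ) (_ : j ≤ i) ↦ eigenspace H (i : K)) i (by omega) le_rfl
      have : x - z ∈ P j := by
        refine Submodule.mem_iSup_of_mem j (Submodule.mem_iSup_of_mem le_rfl ?_)
        rw [mem_eigenspace_iff, ← sub_eq_zero, map_sub]
        rw [← sub_eq_zero] at hzx
        rw [← neg_eq_zero, ← hzx]; module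
      simpa using add_mem this (hle hz)
    intro y hy
    suffices P (j + 1) ≤ (P (j + 1)).map (H - (j : K) • 1) by
      obtain ⟨z, hz, hzy⟩ := this hy
      exact ⟨z, hz, by simpa using hzy⟩
    refine iSup₂_le fun i hi z hz ↦ ⟨((i : K) - j)⁻¹ • z, Submodule.smul_mem _ _
      (Submodule.mem_iSup_of_mem i (Submodule.mem_iSup_of_mem hi hz)), ?_⟩
    have hij : (i : K) - j ≠ 0 := sub_ne_zero.mpr (by exact_mod_cast (by omega : i ≠ j))
    simp only [LinearMap.sub_apply, LinearMap.smul_apply, Module.End.one_apply, map_smul]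
    rw [mem_eigenspace_iff.mp hz, ← sub_smul, inv_smul_smul₀ hij]
  rw [eq_top_iff]
  rintro v -
  suffices ∀ n, (E ^ n) v ∈ U → v ∈ U from this N (by simp [hN])
  intro n
  induction n with
  | zero => simp
  | succ n ih => exact fun h ↦ ih (key _ (by rwa [← Module.End.mul_apply, ← pow_succ']))

open Module.End in
/-- A vector `g` that `H` maps into the range of `E` is in the sum of the kernel and the range of
`E`. This is what is needed of the vanishing of the second cohomology of `sl₂`. -/
theorem exists_eq_add_apply_of_apply_mem_range {N : ℕ} (hN : E ^ N = 0)
    (hEF : ∀ v, E (F v) = F (E v) + H v) (hHE : ∀ v, H (E v) = E (H v) + (2 : K) • E v)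
    (hHF : ∀ v, H (F v) = F (H v) - (2 : K) • F v) {g : V} (hg : H g ∈ E.range) :
    ∃ t c, E t = 0 ∧ g = t + E c := by
  have htop := iSup_eigenspace_eq_top_of_slTwo hN hEF hHE hHF
  obtain ⟨w, -, hw⟩ := exists_sub_mem_eigenspace (H := H) (0 : K) (v := g) (by simp [htop])
  simp only [zero_smul, sub_zero] at hw
  have hw0 : H (g - H w) = 0 := by simpa using mem_eigenspace_iff.mp hw
  -- `H (H w) = H g` lies in `E.range`, and `H` is diagonalizable modulo `E.range`, so that already
  -- `H w ∈ E.range`.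
  obtain ⟨r, hr⟩ : H w ∈ E.range := by
    have hR : E.range ≤ E.range.comap H := by
      rintro _ ⟨v, rfl⟩
      exact ⟨H v + (2 : K) • v, by rw [hHE, map_add, map_smul]⟩
    let Q : Module.End K (V ⧸ E.range) := E.range.mapQ E.range H hR
    have hQ (v : V) : Q (E.range.mkQ v) = E.range.mkQ (H v) := rfl
    have hQtop : E.range.mkQ w ∈ ⨆ μ, eigenspace Q μ := by
      suffices ⊤ ≤ (⨆ μ, eigenspace Q μ).comap E.range.mkQ from this (Submodule.mem_top (x := w))
      rw [← htop]
      refine iSup_le fun μ z hz ↦ Submodule.mem_iSup_of_mem μ (mem_eigenspace_iff.mpr ?_)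
      rw [hQ, mem_eigenspace_iff.mp hz, map_smul]
    have := eigenspace_of_mem_iSup_eigenspace (c := (0 : K)) hQtop (by
      rw [map_sub, sub_eq_zero] at hw0
      rw [zero_smul, sub_zero, mem_eigenspace_iff, hQ, hQ, zero_smul, ← LinearMap.mem_ker,
        Submodule.ker_mkQ, ← hw0]
      exact hg)
    rw [mem_eigenspace_iff, zero_smul, hQ, ← LinearMap.mem_ker, Submodule.ker_mkQ] at this
    exact this
  -- `E (g - H w)` has weight `2`, so it is `E (E u)`.
  obtain ⟨u, hu⟩ := exists_apply_apply_eq_of_eigenvector_two hEF hHE hHF N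
    (v := E (g - H w)) (by simp [hN]) (by rw [hHE, hw0, map_zero, zero_add])
  exact ⟨g - H w - E u, r + u, by rw [map_sub, hu, sub_self], by rw [map_add, hr]; abel⟩

end LinearAlgebra

namespace LieAlgebra

/-! ### The Jacobson-Morozov theorem and the Jordan decomposition -/

section JacobsonMorozov

/-- An element `e` is nilpositive if it is the element `e` of a triple `h, e, f` satisfying the
relations of `sl₂`. Unlike in `IsSl2Triple`, all three are allowed to be zero. -/
def IsNilpositive (K : Type*) {L : Type*} [Field K] [LieRing L] [LieAlgebra K L] (e : L) : Prop :=
  ∃ h f : L, ⁅h, e⁆ = (2 : K) • e ∧ ⁅e, f⁆ = h ∧ ⁅h, f⁆ = -((2 : K) • f)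

variable {K L : Type*} [Field K] [CharZero K] [LieRing L] [LieAlgebra K L] [FiniteDimensional K L]

theorem isNilpotent_ad_of_lie_eq_smul {x y : L} {c : K} (hc : c ≠ 0) (h : ⁅x, y⁆ = c • y) :
    IsNilpotent (ad K L y) := by
  refine Module.End.isNilpotent_of_commutator_eq_smul (X := ad K L x) hc ?_
  ext z
  simp only [LinearMap.sub_apply, Module.End.mul_apply, ad_apply, LinearMap.smul_apply]
  rw [leibniz_lie x y z, h, smul_lie, add_sub_cancel_right]

/-- Morozov's lemma. -/
theorem exists_lie_eq_of_lie_eq_two_smul {h e f' : L} (he : ⁅h, e⁆ = (2 : K) • e)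
    (hf' : ⁅e, f'⁆ = h) : ∃ f, ⁅e, f⁆ = h ∧ ⁅h, f⁆ = -((2 : K) • f) := by
  obtain ⟨N, hN⟩ := isNilpotent_ad_of_lie_eq_smul two_ne_zero he
  have hHE (v : L) : ad K L h (ad K L e v) = ad K L e (ad K L h v) + (2 : K) • ad K L e v := by
    simp only [ad_apply]
    rw [leibniz_lie h e v, he, smul_lie, add_comm]
  have hEF (v : L) : ad K L e (ad K L f' v) = ad K L f' (ad K L e v) + ad K L h v := by
    simp only [ad_apply]
    rw [leibniz_lie e f' v, hf', add_comm]
  -- `⁅h, f'⁆ + 2 • f'` lies in the kernel of `ad e`, on which `ad h` has only eigenvalues in `ℕ`,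
  -- so that `ad h + 2` is onto there: `f'` is corrected by a preimage.
  let P : Submodule K L := (ad K L e).ker.map (ad K L h + (2 : K) • 1)
  have hz : ad K L e (⁅h, f'⁆ + (2 : K) • f') = 0 := by
    rw [map_add, map_smul, ad_apply, ad_apply, leibniz_lie, hf', lie_self, add_zero,
      ← lie_skew e h, he, neg_lie, smul_lie, hf', neg_add_cancel]
  have hP : ⁅h, f'⁆ + (2 : K) • f' ∈ P := by
    refine ker_induction hN hEF hHE ⊥ (by simp) (by simp) (by simp) (fun _ ↦ P) (by simp) ?_
      (by simpa using hz)
    rintro j v hv ⟨k, hk, hkv⟩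
    have hj : (j : K) + 2 ≠ 0 := by exact_mod_cast Nat.succ_ne_zero (j + 1)
    refine ⟨((j : K) + 2)⁻¹ • (v - k), Submodule.smul_mem _ _ (sub_mem (by simpa using hv) hk), ?_⟩
    rw [map_smul, map_sub, hkv, inv_smul_eq_iff₀ hj]
    simp only [LinearMap.add_apply, LinearMap.smul_apply, Module.End.one_apply]
    module
  obtain ⟨k, hk, hkf⟩ := hP
  have hk0 : ⁅e, k⁆ = 0 := hk
  refine ⟨f' - k, by rw [lie_sub, hf', hk0, sub_zero], ?_⟩
  simp only [LinearMap.add_apply, LinearMap.smul_apply, Module.End.one_apply, ad_apply] at hkf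
  rw [lie_sub, ← sub_eq_zero]
  rw [← sub_eq_zero] at hkf
  rw [← neg_eq_zero, ← hkf]
  module

theorem exists_lie_lie_eq_of_isNilpotent_ad [IsKilling K L] {y : L}
    (hy : IsNilpotent (ad K L y)) : ∃ z, ⁅y, ⁅y, z⁆⁆ = y := by
  by_contra! hne
  -- If `y` is not in the range of `(ad y) ^ 2`, some `killingForm z` vanishes on this range, which
  -- means `(ad y) ^ 2 z = 0`, but not at `y`.
  have hmem : y ∉ (ad K L y * ad K L y).range := by
    rintro ⟨z, hz⟩
    exact hne z hz
  obtain ⟨φ, hφy, hφ⟩ := Submodule.exists_le_ker_of_notMem hmem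
  obtain ⟨z, rfl⟩ : ∃ z, killingForm K L z = φ :=
    ((killingForm K L).toDual (IsKilling.killingForm_nondegenerate K L)).surjective φ
  have hz : ⁅y, ⁅y, z⁆⁆ = 0 := by
    have hker : ⁅y, ⁅y, z⁆⁆ ∈ LinearMap.ker (killingForm K L) := by
      rw [LinearMap.mem_ker]
      ext x
      have := hφ ⟨x, rfl⟩
      rw [LinearMap.mem_ker, Module.End.mul_apply, ad_apply, ad_apply] at this
      rw [LinearMap.zero_apply, ← this]
      rw [killingForm, LieModule.traceForm_apply_lie_apply', LieModule.traceForm_apply_lie_apply',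
        neg_neg]
    simpa using hker
  refine hφy ?_
  rw [killingForm_apply_apply, ← Module.End.mul_eq_comp, LinearMap.trace_mul_comm]
  refine LinearMap.trace_mul_eq_zero_of_isNilpotent hy ?_
  have h1 (a b : L) : ad K L a * ad K L b - ad K L b * ad K L a = ad K L ⁅a, b⁆ := by
    ext x
    simp
  rw [h1, commute_iff_eq, ← sub_eq_zero, h1, hz, map_zero]

/-- The **Jacobson-Morozov theorem**. -/
theorem isNilpositive_of_isNilpotent_ad [IsKilling K L] {e : L} (he : IsNilpotent (ad K L e)) :
    IsNilpositive K e := by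
  obtain ⟨z, hz⟩ := exists_lie_lie_eq_of_isNilpotent_ad he
  -- The witness `h = ⁅e, -2 • z⁆` is normalized so that `⁅h, e⁆ = 2 • ⁅e, ⁅e, z⁆⁆ = 2 • e`.
  have hh : ⁅⁅e, (-2 : K) • z⁆, e⁆ = (2 : K) • e := by
    rw [lie_smul, smul_lie, ← lie_skew, hz]
    module
  obtain ⟨f, hf⟩ := exists_lie_eq_of_lie_eq_two_smul hh rfl
  exact ⟨_, f, hh, hf⟩

attribute [local instance 100] LieRing.ofAssociativeRing

/-- A Jordan decomposition in a Lie algebra with nondegenerate Killing form. That `ad u` and `ad y`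
are the semisimple and nilpotent parts of `ad x` is not asserted. -/
theorem exists_ad_isSemisimple_isNilpotent [IsKilling K L] (x : L) :
    ∃ u y : L, x = u + y ∧ (ad K L u).IsSemisimple ∧ IsNilpotent (ad K L y) := by
  obtain ⟨n, hn, s, hs, hnil, hss, hx⟩ := (ad K L x).exists_isNilpotent_isSemisimple
  have hcomm : Commute n s :=
    Algebra.commute_of_mem_adjoin_singleton_of_commute hs
      (Algebra.commute_of_mem_adjoin_self hn).symm
  have hinj : Function.Injective (ad K L) := by
    rw [← LieHom.ker_eq_bot, ad_ker_eq_bot_of_hasTrivialRadical]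
  -- `[s, ·]` preserves the copy `N` of `L` inside `End L`, being a polynomial in `[ad x, ·]`; it
  -- therefore induces a derivation `σ` of `L`, which is inner.
  let N : Submodule K (Module.End K L) := (ad K L : L →ₗ[K] Module.End K L).range
  let S : Module.End K (Module.End K L) := ad K _ s
  have hD : N ∈ Module.End.invtSubmodule (ad K (Module.End K L) (n + s)) := by
    rintro _ ⟨z, rfl⟩
    exact ⟨⁅x, z⁆, by simp [← hx]⟩
  have hS : N ∈ Module.End.invtSubmodule S :=
    Module.End.mem_invtSubmodule_of_mem_adjoin hD (ad_mem_adjoin_of_isSemisimple hcomm hnil hss)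
  let ε : L ≃ₗ[K] N := LinearEquiv.ofInjective (ad K L : L →ₗ[K] Module.End K L) hinj
  let σ : Module.End K L := ε.symm.conj (S.restrict hS)
  have hσ (a : L) : ad K L (σ a) = ⁅s, ad K L a⁆ := by
    have : (ε (σ a) : Module.End K L) = S (ε a) := by
      simp only [σ, LinearEquiv.conj_apply, LinearEquiv.symm_symm, LinearMap.comp_apply,
        LinearEquiv.coe_coe, LinearEquiv.apply_symm_apply]
      rfl
    exact this
  have hσss : σ.IsSemisimple := by
    refine (LinearEquiv.isSemisimple_iff σ (S.restrict hS) ε ?_).mpr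
      ((ad_isSemisimple_of_isSemisimple hss).restrict hS)
    ext a
    simp [σ, LinearEquiv.conj_apply]
  let δ : LieDerivation K L L :=
    { toLinearMap := σ
      leibniz' := fun a b ↦ by
        apply hinj
        simp only [map_sub, LieHom.map_lie, hσ]
        rw [leibniz_lie s, ← lie_skew (ad K L b)]
        abel }
  obtain ⟨u, hu⟩ := LieDerivation.IsKilling.exists_eq_ad δ
  have hu' : ad K L u = σ := by
    ext a
    rw [← LieDerivation.coe_ad_apply_eq_ad_apply, hu]
  refine ⟨u, x - u, by abel, hu' ▸ hσss, ?_⟩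
  -- `ad (x - u)` is the map which `[n, ·]` induces on `L`.
  have hn' (a : L) : ad K L (ad K L (x - u) a) = ad K _ n (ad K L a) := by
    rw [map_sub, hu', LinearMap.sub_apply, map_sub, hσ, ad_apply, LieHom.map_lie, hx, add_lie,
      add_sub_cancel_right, ad_apply]
  obtain ⟨k, hk⟩ := ad_nilpotent_of_nilpotent (R := K) hnil
  refine ⟨k, LinearMap.ext fun a ↦ hinj ?_⟩
  have (j : ℕ) : ad K L ((ad K L (x - u) ^ j) a) = (ad K _ n ^ j) (ad K L a) := by
    induction j with
    | zero => simp
    | succ j ih =>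
      rw [pow_succ', Module.End.mul_apply, hn', ih, ← Module.End.mul_apply, ← pow_succ']
  rw [this, hk]
  simp

end JacobsonMorozov

/-! ### Quotients by ideals and lifting of `sl₂`-triples -/

section Quotient

variable {K L M : Type*} [Field K] [LieRing L] [LieAlgebra K L] [LieRing M] [LieAlgebra K M]

/-- The projection `L → L ⧸ I`, as a homomorphism of Lie algebras. -/
def quotientMk (I : LieIdeal K L) : L →ₗ⁅K⁆ L ⧸ I :=
  { I.toSubmodule.mkQ with map_lie' := rfl }

theorem quotientMk_surjective (I : LieIdeal K L) : Function.Surjective (quotientMk I) :=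
  I.toSubmodule.mkQ_surjective

theorem quotientMk_eq_zero {I : LieIdeal K L} {x : L} : quotientMk I x = 0 ↔ x ∈ I :=
  LieSubmodule.Quotient.mk_eq_zero'

theorem quotientMk_eq_iff {I : LieIdeal K L} {x y : L} :
    quotientMk I x = quotientMk I y ↔ x - y ∈ I := by
  rw [← quotientMk_eq_zero, map_sub, sub_eq_zero]

/-- The projection `L ⧸ I → L ⧸ J` for ideals `I ≤ J`, as a homomorphism of Lie algebras. -/
def quotientFactor {I J : LieIdeal K L} (h : I ≤ J) : L ⧸ I →ₗ⁅K⁆ L ⧸ J :=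
  { Submodule.factor (p := I.toSubmodule) (p' := J.toSubmodule) h with
    map_lie' := by
      rintro ⟨x⟩ ⟨y⟩
      rfl }

theorem quotientFactor_mk {I J : LieIdeal K L} (h : I ≤ J) (x : L) :
    quotientFactor h (quotientMk I x) = quotientMk J x :=
  rfl

variable [FiniteDimensional K L]

theorem hasTrivialRadical_quotient_radical : HasTrivialRadical K (L ⧸ radical K L) := by
  refine hasTrivialRadical_of_no_solvable_ideals fun J hJ ↦ ?_
  let π := quotientMk (radical K L)
  obtain ⟨k, hk⟩ := IsSolvable.solvable K J
  obtain ⟨l, hl⟩ := IsSolvable.solvable K (radical K L)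
  rw [LieIdeal.derivedSeries_eq_bot_iff] at hk hl
  have hle (j : ℕ) : derivedSeriesOfIdeal K L j (J.comap π) ≤
      (derivedSeriesOfIdeal K (L ⧸ radical K L) j J).comap π := by
    induction j with
    | zero => exact le_rfl
    | succ j ih =>
      rw [derivedSeriesOfIdeal_succ, derivedSeriesOfIdeal_succ]
      exact (LieSubmodule.mono_lie ih ih).trans (LieIdeal.comap_bracket_le π)
  have hR : derivedSeriesOfIdeal K L k (J.comap π) ≤ radical K L := fun x hx ↦ by
    have := hle k hx
    rwa [hk, LieIdeal.mem_comap, LieSubmodule.mem_bot, quotientMk_eq_zero] at this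
  have hsol : IsSolvable (J.comap π) := by
    refine IsSolvable.mk (R := K) (k := l + k) ?_
    rw [LieIdeal.derivedSeries_eq_bot_iff, derivedSeriesOfIdeal_add, eq_bot_iff, ← hl]
    exact derivedSeriesOfIdeal_mono hR l
  rw [eq_bot_iff]
  intro y hy
  obtain ⟨x, rfl⟩ := quotientMk_surjective _ y
  rw [LieSubmodule.mem_bot, quotientMk_eq_zero]
  exact (LieIdeal.solvable_iff_le_radical K L _).mp hsol (LieIdeal.mem_comap.mpr hy)

variable [CharZero K]

/-- A triple is lifted through an abelian kernel by correcting the lifts of `h` and `e` with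
elements of the kernel; Morozov's lemma then completes them to a triple. -/
theorem exists_isNilpositive_of_surjective_of_ker_abelian (q : L →ₗ⁅K⁆ M)
    (hq : Function.Surjective q) (hab : ∀ a b, q a = 0 → q b = 0 → ⁅a, b⁆ = 0) {x : M}
    (hx : IsNilpositive K x) : ∃ e, q e = x ∧ IsNilpositive K e := by
  obtain ⟨h', f', hhe, hef, hhf⟩ := hx
  obtain ⟨h, rfl⟩ := hq h'
  obtain ⟨e, rfl⟩ := hq x
  obtain ⟨f, rfl⟩ := hq f'
  have mem (a : L) : q a = 0 → ∀ b : q.ker, ⁅a, b⁆ = 0 := fun ha b ↦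
    Subtype.ext (hab _ _ ha (LieHom.mem_ker.mp b.2))
  -- Arbitrary lifts `h, e, f` satisfy the relations of `sl₂` on the abelian ideal `q.ker`.
  have hEF (v : q.ker) : ⁅e, ⁅f, v⁆⁆ = ⁅f, ⁅e, v⁆⁆ + ⁅h, v⁆ := by
    have : ⁅⁅e, f⁆ - h, v⁆ = 0 := mem _ (by rw [map_sub, LieHom.map_lie, hef, sub_self]) v
    rw [leibniz_lie e f v, ← sub_eq_zero, ← this, sub_lie]
    abel
  have hHE (v : q.ker) : ⁅h, ⁅e, v⁆⁆ = ⁅e, ⁅h, v⁆⁆ + (2 : K) • ⁅e, v⁆ := by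
    have : ⁅⁅h, e⁆ - (2 : K) • e, v⁆ = 0 :=
      mem _ (by rw [map_sub, LieHom.map_lie, hhe, map_smul, sub_self]) v
    rw [leibniz_lie h e v, ← sub_eq_zero, ← this, sub_lie, smul_lie]
    abel
  have hHF (v : q.ker) : ⁅h, ⁅f, v⁆⁆ = ⁅f, ⁅h, v⁆⁆ - (2 : K) • ⁅f, v⁆ := by
    have : ⁅⁅h, f⁆ + (2 : K) • f, v⁆ = 0 :=
      mem _ (by rw [map_add, LieHom.map_lie, hhf, map_smul, neg_add_cancel]) v
    rw [leibniz_lie h f v, ← sub_eq_zero, ← this, add_lie, smul_lie]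
    abel
  let E := LieModule.toEnd K L q.ker e
  let F := LieModule.toEnd K L q.ker f
  let H := LieModule.toEnd K L q.ker h
  obtain ⟨N, hN⟩ : IsNilpotent E := by
    refine Module.End.isNilpotent_of_commutator_eq_smul (X := H) (c := 2) two_ne_zero ?_
    ext1 v
    exact sub_eq_iff_eq_add'.mpr (hHE v)
  have htop := iSup_eigenspace_eq_top_of_slTwo (E := E) (F := F) (H := H) hN hEF hHE hHF
  -- Correction of `h` and `e` by elements `u` and `-w` of `q.ker`, to have `⁅h, e⁆ = 2 • e`.
  have hα : q (⁅h, e⁆ - (2 : K) • e) = 0 := by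
    rw [map_sub, LieHom.map_lie, hhe, map_smul, sub_self]
  obtain ⟨w, -, hw⟩ := exists_sub_mem_eigenspace (H := H) (2 : K)
    (v := ⟨⁅h, e⁆ - (2 : K) • e, by simpa using hα⟩) (by simp [htop])
  obtain ⟨u, -, hu⟩ := exists_apply_eq_of_eigenvector (E := E) (F := F) (H := H) hEF hHE hHF
    (k := 2) (fun j ↦ by exact_mod_cast (by omega : 2 + j ≠ 0)) N (by simp [hN])
    (Module.End.mem_eigenspace_iff.mp hw)
  have hwq : q w = 0 := LieHom.mem_ker.mp w.2
  have huq : q u = 0 := LieHom.mem_ker.mp u.2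
  have hu' : ⁅e, (u : L)⁆ = ⁅h, e⁆ - (2 : K) • e - (⁅h, (w : L)⁆ - (2 : K) • (w : L)) :=
    congrArg Subtype.val hu
  have hhe1 : ⁅h + u, e - w⁆ = (2 : K) • (e - w) := by
    rw [lie_sub, add_lie, add_lie, hab _ _ huq hwq, ← lie_skew (u : L) e, hu']
    module
  have actE (v : q.ker) : ⁅e - (w : L), v⁆ = ⁅e, v⁆ := by
    rw [sub_lie, mem _ hwq, sub_zero]
  have actH (v : q.ker) : ⁅h + (u : L), v⁆ = ⁅h, v⁆ := by
    rw [add_lie, mem _ huq, add_zero]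
  -- The defect `γ = ⁅e, f⁆ - h` of the second relation satisfies `⁅h, γ⁆ ∈ ⁅e, q.ker⁆`, so
  -- `γ = t + ⁅e, c⁆` with `⁅e, t⁆ = 0`; then `h + t` and `f - c` satisfy this relation.
  have hγ : q (⁅e - w, f⁆ - (h + u)) = 0 := by
    rw [map_sub, LieHom.map_lie, map_sub, hwq, map_add, huq, sub_zero, add_zero, hef, sub_self]
  have hβ : q (⁅h + u, f⁆ + (2 : K) • f) = 0 := by
    rw [map_add, LieHom.map_lie, map_add, huq, add_zero, hhf, map_smul, neg_add_cancel]
  obtain ⟨t, c, ht, hc⟩ := exists_eq_add_apply_of_apply_mem_range (E := E) (F := F) (H := H)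
    hN hEF hHE hHF (g := ⟨⁅e - w, f⁆ - (h + u), by simpa using hγ⟩)
    ⟨⟨⁅h + u, f⁆ + (2 : K) • f, by simpa using hβ⟩, by
      change ⁅e, _⁆ = ⁅h, _⁆
      rw [← actE, ← actH]
      apply Subtype.ext
      change ⁅e - (w : L), ⁅h + u, f⁆ + (2 : K) • f⁆ = ⁅h + (u : L), ⁅e - (w : L), f⁆ - (h + u)⁆
      rw [lie_sub, lie_self, sub_zero, leibniz_lie (h + (u : L)), hhe1, lie_add, lie_smul, smul_lie]
      abel⟩
  have htq : q t = 0 := LieHom.mem_ker.mp t.2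
  have ht' : ⁅e - (w : L), (t : L)⁆ = 0 := by
    simpa using (congrArg Subtype.val (actE t)).trans (congrArg Subtype.val ht)
  have hc' : ⁅e - (w : L), f⁆ - (h + u) = t + ⁅e - (w : L), (c : L)⁆ := by
    refine (congrArg Subtype.val hc).trans ?_
    exact congrArg (fun z : q.ker ↦ (t : L) + z) (actE c).symm
  have h1 : ⁅h + u + t, e - (w : L)⁆ = (2 : K) • (e - (w : L)) := by
    rw [add_lie, hhe1, ← lie_skew, ht', neg_zero, add_zero]
  have h2 : ⁅e - (w : L), f - c⁆ = h + u + t := by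
    rw [lie_sub, sub_eq_iff_eq_add.mp hc']
    abel
  obtain ⟨g, hg1, hg2⟩ := exists_lie_eq_of_lie_eq_two_smul h1 h2
  exact ⟨e - w, by rw [map_sub, hwq, sub_zero], _, g, h1, hg1, hg2⟩

theorem exists_isNilpositive_of_isSolvable (I : LieIdeal K L) [IsSolvable I] {x : L ⧸ I}
    (hx : IsNilpositive K x) : ∃ e : L, quotientMk I e = x ∧ IsNilpositive K e := by
  -- Lift successively modulo the terms of the derived series of `I`.
  have key (k : ℕ) : ∃ e : L, quotientMk I e = x ∧
      IsNilpositive K (quotientMk (derivedSeriesOfIdeal K L k I) e) := by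
    induction k with
    | zero =>
      obtain ⟨e, rfl⟩ := quotientMk_surjective I x
      exact ⟨e, rfl, hx⟩
    | succ k ih =>
      obtain ⟨e, rfl, he⟩ := ih
      obtain ⟨y, hy, hy'⟩ := exists_isNilpositive_of_surjective_of_ker_abelian
        (quotientFactor (derivedSeriesOfIdeal_succ_le (R := K) I k))
        (fun y ↦ by
          obtain ⟨y, rfl⟩ := quotientMk_surjective _ y
          exact ⟨quotientMk _ y, rfl⟩) (fun a b ha hb ↦ by
          obtain ⟨a, rfl⟩ := quotientMk_surjective _ a
          obtain ⟨b, rfl⟩ := quotientMk_surjective _ b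
          rw [quotientFactor_mk, quotientMk_eq_zero] at ha hb
          rw [← LieHom.map_lie, quotientMk_eq_zero, derivedSeriesOfIdeal_succ]
          exact LieSubmodule.lie_mem_lie ha hb) he
      obtain ⟨e', rfl⟩ := quotientMk_surjective _ y
      rw [quotientFactor_mk, quotientMk_eq_iff] at hy
      exact ⟨e', quotientMk_eq_iff.mpr (derivedSeriesOfIdeal_le_self I k hy), hy'⟩
  obtain ⟨k, hk⟩ := IsSolvable.solvable K I
  rw [LieIdeal.derivedSeries_eq_bot_iff] at hk
  obtain ⟨e, he, h, f, h1, h2, h3⟩ := key k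
  obtain ⟨h, rfl⟩ := quotientMk_surjective _ h
  obtain ⟨f, rfl⟩ := quotientMk_surjective _ f
  have inj : Function.Injective (quotientMk (derivedSeriesOfIdeal K L k I)) := fun a b hab ↦ by
    rwa [quotientMk_eq_iff, hk, LieSubmodule.mem_bot, sub_eq_zero] at hab
  refine ⟨e, he, h, f, inj ?_, inj ?_, inj ?_⟩
  · rwa [LieHom.map_lie, map_smul]
  · rwa [LieHom.map_lie]
  · rwa [LieHom.map_lie, map_neg, map_smul]

end Quotient

/-! ### The span of the inertial elements -/

section Inertial

variable {K L : Type*} [Field K] [LieRing L] [LieAlgebra K L]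

/-- The subspace of `L` spanned by the inertial elements. -/
def inertialSpan (K L : Type*) [Field K] [LieRing L] [LieAlgebra K L] : Submodule K L :=
  Submodule.span K {y | IsInertial K y}

theorem mem_inertialSpan_of_lie_eq_smul {x y : L} {c : K} (hc : c ≠ 0) (h : ⁅x, y⁆ = c • y) :
    y ∈ inertialSpan K L := by
  by_cases hy : y = 0
  · exact hy ▸ zero_mem _
  · exact Submodule.subset_span ⟨x, c, hc, Module.End.mem_eigenspace_iff.mpr h, hy⟩

variable [FiniteDimensional K L]

theorem isInertiallyGenerated_of_inertialSpan_eq_top (h : inertialSpan K L = ⊤) :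
    IsInertiallyGenerated K L := by
  let b := Module.Basis.ofSpan (ge_of_eq h)
  have hfin := FiniteDimensional.fintypeBasisIndex b
  refine ⟨_, b.reindex (Fintype.equivFin _), fun i ↦ ?_⟩
  rw [Module.Basis.reindex_apply]
  exact Module.Basis.ofSpan_subset (ge_of_eq h) ⟨_, rfl⟩

variable [CharZero K]

/-- The automorphism `exp (ad a)` takes the inertial element `b` to an inertial element, from which
`⁅a, b⁆` is recovered by subtracting eigenvectors of `ad h`. -/
theorem lie_mem_inertialSpan_of_opposite {h a b : L} {c : K} (hc : c ≠ 0) (ha : ⁅h, a⁆ = c • a)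
    (hb : ⁅h, b⁆ = -c • b) : ⁅a, b⁆ ∈ inertialSpan K L := by
  -- `LieDerivation.exp` is stated for a Lie algebra over `ℚ`.
  let _ : Module ℚ L := Module.compHom L (algebraMap ℚ K)
  let _ : LieAlgebra ℚ L := { lie_smul := fun r x y ↦ lie_smul (algebraMap ℚ K r) x y }
  have hnil := isNilpotent_ad_of_lie_eq_smul hc ha
  have hnil' : IsNilpotent (LieDerivation.ad K L a).toLinearMap :=
    (LieDerivation.coe_ad_apply_eq_ad_apply (R := K) a).symm ▸ hnil
  let φ := LieDerivation.exp (LieDerivation.ad K L a) hnil'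
  have hφ : φ b ∈ inertialSpan K L :=
    mem_inertialSpan_of_lie_eq_smul (neg_ne_zero.mpr hc) (x := φ h) (by
      rw [← LieEquiv.map_lie, hb, map_smul])
  obtain ⟨N, hN⟩ := hnil
  have hN' : ad K L a ^ (N + 2) = 0 := pow_eq_zero_of_le (by omega) hN
  have hsum : φ b = ∑ i ∈ Finset.range (N + 2),
      (algebraMap ℚ K (i.factorial : ℚ)⁻¹) • (ad K L a ^ i) b := by
    rw [LieDerivation.exp_map_apply, LieDerivation.coe_ad_apply_eq_ad_apply,
      IsNilpotent.exp_eq_sum hN', LinearMap.sum_apply]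
    rfl
  -- The term of index `1` is `⁅a, b⁆`; the others are eigenvectors of `ad h` with nonzero
  -- eigenvalue.
  rw [← Finset.add_sum_erase _ _ (show 1 ∈ Finset.range (N + 2) by simp)] at hsum
  have hrest : ∑ i ∈ (Finset.range (N + 2)).erase 1,
      (algebraMap ℚ K (i.factorial : ℚ)⁻¹) • (ad K L a ^ i) b ∈ inertialSpan K L := by
    refine sum_mem fun i hi ↦ Submodule.smul_mem _ _ ?_
    have hi1 : i ≠ 1 := Finset.ne_of_mem_erase hi
    have hi (i : ℕ) : ⁅h, (ad K L a ^ i) b⁆ = (((i : K) - 1) * c) • (ad K L a ^ i) b := by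
      induction i with
      | zero => simpa using hb
      | succ i ih =>
        rw [pow_succ', Module.End.mul_apply, ad_apply, leibniz_lie, ha, ih, smul_lie, lie_smul]
        push_cast
        module
    refine mem_inertialSpan_of_lie_eq_smul (mul_ne_zero ?_ hc) (hi i)
    rw [sub_ne_zero]
    exact_mod_cast hi1
  have : ⁅a, b⁆ = φ b - ∑ i ∈ (Finset.range (N + 2)).erase 1,
      (algebraMap ℚ K (i.factorial : ℚ)⁻¹) • (ad K L a ^ i) b := by
    rw [hsum, add_sub_cancel_right]
    simp
  rw [this]
  exact sub_mem hφ hrest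

open Module.End in
/-- If `ad h` is diagonalizable, its eigenvectors for nonzero eigenvalues generate an ideal inside
the span of the inertial elements. With `U` the span of these eigenvectors, it is `U + ⁅U, U⁆`. -/
theorem exists_lieIdeal_le_inertialSpan {h : L} (hh : ⨆ μ, eigenspace (ad K L h) μ = ⊤) :
    ∃ I : LieIdeal K L, I.toSubmodule ≤ inertialSpan K L ∧
      ∀ (c : K) (e : L), c ≠ 0 → ⁅h, e⁆ = c • e → e ∈ I := by
  let U : Submodule K L := ⨆ μ : {μ : K // μ ≠ 0}, eigenspace (ad K L h) μ
  let B : Submodule K L := Submodule.span K {z | ∃ a ∈ U, ∃ b ∈ U, ⁅a, b⁆ = z}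
  have mem_eig {μ : K} {v : L} : v ∈ eigenspace (ad K L h) μ ↔ ⁅h, v⁆ = μ • v := mem_eigenspace_iff
  have hW (x : L) : ∃ w ∈ eigenspace (ad K L h) 0, ∃ u ∈ U, w + u = x := by
    rw [← Submodule.mem_sup]
    suffices (⨆ μ, eigenspace (ad K L h) μ) ≤ eigenspace (ad K L h) 0 ⊔ U from
      this (hh ▸ Submodule.mem_top)
    refine iSup_le fun μ ↦ ?_
    by_cases hμ : μ = 0
    · exact hμ ▸ le_sup_left
    · exact le_sup_of_le_right
        (le_iSup (fun μ : {μ : K // μ ≠ 0} ↦ eigenspace (ad K L h) μ) ⟨μ, hμ⟩)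
  have hWU {w u : L} (hw : w ∈ eigenspace (ad K L h) 0) (hu : u ∈ U) : ⁅w, u⁆ ∈ U := by
    suffices U ≤ U.comap (ad K L w) from this hu
    refine iSup_le fun μ v hv ↦ Submodule.mem_iSup_of_mem μ (mem_eig.mpr ?_)
    rw [ad_apply, leibniz_lie, mem_eig.mp hw, mem_eig.mp hv]
    simp
  have hUU {a b : L} (ha : a ∈ U) (hb : b ∈ U) : ⁅a, b⁆ ∈ B :=
    Submodule.subset_span ⟨a, ha, b, hb, rfl⟩
  have hUL {u : L} (x : L) (hu : u ∈ U) : ⁅u, x⁆ ∈ U ⊔ B := by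
    obtain ⟨w, hw, u', hu', rfl⟩ := hW x
    rw [lie_add, ← lie_skew]
    exact add_mem (neg_mem (Submodule.mem_sup_left (hWU hw hu)))
      (Submodule.mem_sup_right (hUU hu hu'))
  refine ⟨⟨U ⊔ B, ?_⟩, ?_, ?_⟩
  · intro x m hm
    obtain ⟨w, hw, u, hu, rfl⟩ := hW x
    rw [add_lie]
    refine add_mem ?_ (hUL m hu)
    suffices U ⊔ B ≤ (U ⊔ B).comap (ad K L w) from this hm
    refine sup_le (fun v hv ↦ Submodule.mem_sup_left (hWU hw hv))
      (Submodule.span_le.mpr ?_)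
    rintro _ ⟨a, ha, b, hb, rfl⟩
    refine Submodule.mem_sup_right ?_
    rw [ad_apply, leibniz_lie]
    exact add_mem (hUU (hWU hw ha) hb) (hUU ha (hWU hw hb))
  · refine sup_le (iSup_le fun μ v hv ↦ mem_inertialSpan_of_lie_eq_smul μ.2 (mem_eig.mp hv))
      (Submodule.span_le.mpr ?_)
    rintro _ ⟨a, ha, b, hb, rfl⟩
    suffices U ≤ (inertialSpan K L).comap (ad K L a) from this hb
    refine iSup_le fun ν b hb ↦ ?_
    suffices U ≤ (inertialSpan K L).comap (ad K L b) by
      rw [Submodule.mem_comap, ad_apply, ← lie_skew]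
      exact neg_mem (this ha)
    refine iSup_le fun μ a ha ↦ ?_
    rw [mem_eig] at ha hb
    rw [Submodule.mem_comap, ad_apply, ← lie_skew]
    refine neg_mem ?_
    -- For nonopposite weights the bracket is itself an eigenvector with nonzero eigenvalue.
    by_cases hμν : (μ : K) + ν = 0
    · exact lie_mem_inertialSpan_of_opposite μ.2 ha (by rw [hb, eq_neg_of_add_eq_zero_right hμν])
    · refine mem_inertialSpan_of_lie_eq_smul hμν (x := h) ?_
      rw [leibniz_lie, ha, hb, smul_lie, lie_smul, add_smul]
  · intro c e hc he
    exact Submodule.mem_sup_left (Submodule.mem_iSup_of_mem ⟨c, hc⟩ (mem_eig.mpr he))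

theorem exists_lieIdeal_le_inertialSpan_of_isNilpositive :
    ∃ J : LieIdeal K L, J.toSubmodule ≤ inertialSpan K L ∧ ∀ e, IsNilpositive K e → e ∈ J := by
  -- The largest ideal contained in the span works.
  refine ⟨sSup {I : LieIdeal K L | I.toSubmodule ≤ inertialSpan K L}, ?_, ?_⟩
  · rw [LieSubmodule.sSup_toSubmodule]
    exact sSup_le (by rintro _ ⟨I, hI, rfl⟩; exact hI)
  · rintro e ⟨h, f, hhe, hef, hhf⟩
    obtain ⟨N, hN⟩ := isNilpotent_ad_of_lie_eq_smul two_ne_zero hhe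
    obtain ⟨I, hI, heI⟩ := exists_lieIdeal_le_inertialSpan (h := h)
      (iSup_eigenspace_eq_top_of_slTwo (E := ad K L e) (F := ad K L f) hN
        (fun v ↦ by simp only [ad_apply]; rw [leibniz_lie e f v, hef, add_comm])
        (fun v ↦ by simp only [ad_apply]; rw [leibniz_lie h e v, hhe, smul_lie, add_comm])
        (fun v ↦ by
          simp only [ad_apply]
          rw [leibniz_lie h f v, hhf, neg_lie, smul_lie, neg_add_eq_sub]))
    exact (le_sSup (show I ∈ {I : LieIdeal K L | I.toSubmodule ≤ inertialSpan K L} from hI))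
      (heI 2 e two_ne_zero hhe)

end Inertial

/-! ### Toral quotients -/

section Toral

variable {K L : Type*} [Field K] [LieRing L] [LieAlgebra K L]

theorem IsPluperfect.eq_top (hL : IsPluperfect K L) {I : LieIdeal K L} (hI : IsToral K (L ⧸ I)) :
    I = ⊤ := by
  have := hL I hI
  refine eq_top_iff.mpr fun x _ ↦ quotientMk_eq_zero.mp (Subsingleton.elim _ _)

/-- A pluperfect Lie algebra is perfect, since abelian quotients are toral. -/
theorem IsPluperfect.derivedSeries_eq_top (hL : IsPluperfect K L) (k : ℕ) :
    derivedSeries K L k = ⊤ := by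
  refine LieIdeal.derivedSeries_eq_top k (hL.eq_top fun x ↦ ?_)
  have : ad K (L ⧸ derivedSeries K L 1) x = 0 := by
    ext y
    obtain ⟨x, rfl⟩ := quotientMk_surjective _ x
    obtain ⟨y, rfl⟩ := quotientMk_surjective _ y
    rw [ad_apply, ← LieHom.map_lie, LinearMap.zero_apply, quotientMk_eq_zero]
    exact LieSubmodule.lie_mem_lie (LieSubmodule.mem_top x) (LieSubmodule.mem_top y)
  rw [this]
  exact Module.End.isSemisimple_zero

variable [CharZero K] [FiniteDimensional K L]

theorem IsPluperfect.inertialSpan_eq_top (hL : IsPluperfect K L) : inertialSpan K L = ⊤ := by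
  obtain ⟨J, hJ, hJe⟩ := exists_lieIdeal_le_inertialSpan_of_isNilpositive (K := K) (L := L)
  let R := radical K L
  -- `L ⧸ (J ⊔ R)` is toral: in `L ⧸ R` any element is a semisimple one plus a nilpositive one, and
  -- the latter comes from `J`.
  have hsup : J ⊔ R = ⊤ := by
    refine hL.eq_top fun x ↦ ?_
    obtain ⟨x, rfl⟩ := quotientMk_surjective _ x
    have : HasTrivialRadical K (L ⧸ R) := hasTrivialRadical_quotient_radical
    obtain ⟨u, y, hxy, hu, hy⟩ := exists_ad_isSemisimple_isNilpotent (K := K) (quotientMk R x)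
    obtain ⟨e, rfl, he⟩ := exists_isNilpositive_of_isSolvable R (isNilpositive_of_isNilpotent_ad hy)
    let q := quotientFactor (le_sup_right : R ≤ J ⊔ R)
    have hq : Function.Surjective q := fun z ↦ by
      obtain ⟨z, rfl⟩ := quotientMk_surjective _ z
      exact ⟨quotientMk _ z, rfl⟩
    have hqu : q u = quotientMk (J ⊔ R) x := by
      have he0 : q (quotientMk R e) = 0 :=
        quotientMk_eq_zero.mpr ((le_sup_left : J ≤ J ⊔ R) (hJe e he))
      rw [← quotientFactor_mk le_sup_right, hxy, map_add]
      exact (add_eq_left.mpr he0).symm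
    refine hu.of_surjective (q : (L ⧸ R) →ₗ[K] L ⧸ (J ⊔ R)) hq fun v ↦ ?_
    rw [← hqu]
    exact LieHom.map_lie q u v
  obtain ⟨l, hl⟩ := IsSolvable.solvable K R
  rw [LieIdeal.derivedSeries_eq_bot_iff] at hl
  -- A perfect Lie algebra which is solvable modulo `J` equals `J`.
  have hJtop : (⊤ : LieIdeal K L) ≤ J := by
    have := derivedSeriesOfIdeal_add_le_add (R := K) (I := J) R 0 l
    rwa [LieSubmodule.add_eq_sup, LieSubmodule.add_eq_sup, hsup, hl, sup_bot_eq, zero_add,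
      derivedSeriesOfIdeal_zero, ← derivedSeries_def, hL.derivedSeries_eq_top] at this
  exact eq_top_iff.mpr fun x _ ↦ hJ (hJtop (LieSubmodule.mem_top x))

/-- Inertial elements vanish in toral quotients. -/
theorem IsInertial.mem_of_isToral {y : L} (hy : IsInertial K y) {I : LieIdeal K L}
    (hI : IsToral K (L ⧸ I)) : y ∈ I := by
  obtain ⟨x, c, hc, hy, -⟩ := hy
  have hxy : ⁅quotientMk I x, quotientMk I y⁆ = c • quotientMk I y := by
    rw [← LieHom.map_lie, ← map_smul]
    exact congrArg _ (Module.End.mem_eigenspace_iff.mp hy)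
  have h0 : ad K (L ⧸ I) (quotientMk I y) = 0 :=
    Module.End.eq_zero_of_isNilpotent_isSemisimple (isNilpotent_ad_of_lie_eq_smul hc hxy) (hI _)
  have h1 : ⁅quotientMk I x, quotientMk I y⁆ = 0 := by
    rw [← lie_skew, ← ad_apply K, h0, LinearMap.zero_apply, neg_zero]
  rw [h1, eq_comm, smul_eq_zero] at hxy
  exact quotientMk_eq_zero.mp (hxy.resolve_left hc)

theorem IsInertiallyGenerated.isPluperfect (hL : IsInertiallyGenerated K L) : IsPluperfect K L := by
  obtain ⟨d, b, hb⟩ := hL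
  intro I hI
  have htop : I.toSubmodule = ⊤ := by
    rw [eq_top_iff, ← b.span_eq, Submodule.span_le]
    rintro _ ⟨i, rfl⟩
    exact (hb i).mem_of_isToral hI
  exact Submodule.Quotient.subsingleton_iff.mpr htop

end Toral

end LieAlgebra

theorem mainTheorem7 (F L : Type*) [Field F] [CharZero F] [LieRing L] [LieAlgebra F L]
    [FiniteDimensional F L] :
    LieAlgebra.IsPluperfect F L ↔ LieAlgebra.IsInertiallyGenerated F L :=
  ⟨fun h ↦ LieAlgebra.isInertiallyGenerated_of_inertialSpan_eq_top h.inertialSpan_eq_top,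
    LieAlgebra.IsInertiallyGenerated.isPluperfect⟩
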